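/- Let $N\ge 2$ and let $D\subset\mathbb{R}^N$ be a bounded domain with smooth boundary $\partial D$. Let $\Gamma_0,\Gamma_1\subset\partial D$ be disjoint and relatively open in $\partial D$ (hence smooth $(N-1)$-dimensional surfaces; either may be empty), such that $\overline{\Gamma_0},\overline{\Gamma_1}$ are compact smooth manifolds with common $(N-2)$-dimensional closed (possibly empty) boundary $\gamma=\overline{\Gamma_0}\cap\overline{\Gamma_1}$ and $\partial D=\Gamma_0\cup\gamma\cup\Gamma_1$. Let $f:\overline{D}\times[0,\infty)\to\mathbb{R}$ and $g:\overline{\Gamma_1}\times[0,\infty)\to\mathbb{R}$ be continuous, and let $C_1\ge 0$ be a constant. Assume that for every $x\in D$ the map $t\mapsto f(x,t)/t$ is (strictly) decreasing on $(0,\infty)$, and that for every $x\in\Gamma_1$ the map $t\mapsto g(x,t)/t$ is non-increasing on $(0,\infty)$. Let $H^1_{\Gamma_0}(D)$ be the set of $\varphi\in H^1(D)$ whose trace vanishes almost everywhere on $\Gamma_0$ with respect to surface measure. Let $u,v\in H^1(D)\cap C(\overline{D})$ be non-negative functions with $u\le C_1\le v$ on $\Gamma_0$ such that, for all $\varphi\in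 H^1_{\Gamma_0}(D)$ with $\varphi\ge 0$, $$\int_D\nabla u\cdot\nabla\varphi-\int_D f(x,u)\,\varphi-\int_{\Gamma_1}g(x,u)\,\varphi\le 0,$$ $$\int_D\nabla v\cdot\nabla\varphi-\int_D f(x,v)\,\varphi-\int_{\Gamma_1}g(x,v)\,\varphi\ge 0,$$ where the integrals over $\Gamma_1$ are taken with respect to surface measure and involve the trace of $\varphi$. If $v>0$ in $D$, then $u\le v$ on $\overline{D}$. -/

import Mathlib

open MeasureTheory Set Filter Topology
open scoped ContDiff

/-- `D` has a smooth (`C^∞`) boundary: near each boundary point, after a rotation of the axes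
(the vertical axis being spanned by the unit vector `e`), `D` is the region strictly above the
graph of a smooth function of the horizontal part `y - ⟪e, y⟫ e` of `y`. -/
def HasSmoothBoundary {N : ℕ} (D : Set (EuclideanSpace ℝ (Fin N))) : Prop :=
  ∀ x ∈ frontier D, ∃ r > 0, ∃ e : EuclideanSpace ℝ (Fin N), ‖e‖ = 1 ∧
    ∃ h : EuclideanSpace ℝ (Fin N) → ℝ, ContDiff ℝ ∞ h ∧
      ∀ y ∈ Metric.ball x r, (y ∈ D ↔ h (y - inner ℝ e y • e) < inner ℝ e y)

/-- A bounded domain (non-empty connected open set) with smooth boundary. -/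
structure IsSmoothBoundedDomain {N : ℕ} (D : Set (EuclideanSpace ℝ (Fin N))) : Prop where
  isOpen : IsOpen D
  isConnected : IsConnected D
  isBounded : Bornology.IsBounded D
  smoothBoundary : HasSmoothBoundary D

/-- The splitting `∂D = Γ₀ ∪ γ ∪ Γ₁` of the boundary: `Γ₀`, `Γ₁` are disjoint and relatively open
in `∂D` (hence smooth hypersurfaces), `γ = closure Γ₀ ∩ closure Γ₁` is the rest of `∂D`, and the
closures are smooth manifolds with boundary `γ`: near each point of `γ` there is a smooth
function `w`, whose differential does not vanish on the tangent space of `∂D`, such that in `∂D`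
the sets `Γ₀`, `Γ₁` are `{w < 0}` and `{w > 0}` (so `γ` is `{w = 0}`). Either of `Γ₀`, `Γ₁` may
be empty. -/
structure IsBoundarySplitting {N : ℕ} (D Γ₀ Γ₁ : Set (EuclideanSpace ℝ (Fin N))) : Prop where
  disjoint : Disjoint Γ₀ Γ₁
  relOpen₀ : ∃ U, IsOpen U ∧ Γ₀ = U ∩ frontier D
  relOpen₁ : ∃ U, IsOpen U ∧ Γ₁ = U ∩ frontier D
  cover : frontier D = Γ₀ ∪ (closure Γ₀ ∩ closure Γ₁) ∪ Γ₁
  interface : ∀ x ∈ closure Γ₀ ∩ closure Γ₁, ∃ r > 0,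
    ∃ w : EuclideanSpace ℝ (Fin N) → ℝ, ContDiff ℝ ∞ w ∧
      (∃ τ ∈ tangentConeAt ℝ (frontier D) x, fderiv ℝ w x τ ≠ 0) ∧
      ∀ y ∈ Metric.ball x r ∩ frontier D, (y ∈ Γ₀ ↔ w y < 0) ∧ (y ∈ Γ₁ ↔ 0 < w y)

/-- `w ∈ H¹(D)` with weak gradient `G`. -/
structure IsH1 {N : ℕ} (D : Set (EuclideanSpace ℝ (Fin N)))
    (w : EuclideanSpace ℝ (Fin N) → ℝ)
    (G : EuclideanSpace ℝ (Fin N) → EuclideanSpace ℝ (Fin N)) : Prop where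
  memLp : MemLp w 2 (volume.restrict D)
  memLp_grad : MemLp G 2 (volume.restrict D)
  weakGrad : ∀ η : EuclideanSpace ℝ (Fin N) → ℝ, ContDiff ℝ ∞ η → HasCompactSupport η →
    tsupport η ⊆ D → ∀ e : EuclideanSpace ℝ (Fin N),
      ∫ x in D, w x * fderiv ℝ η x e = - ∫ x in D, η x * inner ℝ (G x) e

/-- `T ∈ L²(∂D)` is the boundary trace of `w`, in the pointwise (Lebesgue value) form: for
almost every `x ∈ ∂D` with respect to surface measure, the mean of `|w - T x|` over
`D ∩ B(x, r)` tends to `0` as `r → 0`. The surface measure on `∂D` is the `(N - 1)`-dimensional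
Hausdorff measure `μHE[N - 1]` (with the Euclidean normalization). -/
structure HasTrace {N : ℕ} (D : Set (EuclideanSpace ℝ (Fin N)))
    (w T : EuclideanSpace ℝ (Fin N) → ℝ) : Prop where
  memLp : MemLp T 2 (μHE[N - 1].restrict (frontier D))
  tendsto : ∀ᵐ x ∂(μHE[N - 1].restrict (frontier D)),
    Tendsto (fun r : ℝ => ⨍ y in D ∩ Metric.ball x r, |w y - T x|) (𝓝[>] 0) (𝓝 0)

/-- `φ ∈ H¹_{Γ₀}(D)`, that is, `φ ∈ H¹(D)` and its trace vanishes on `Γ₀`; here `G` is the weak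
gradient and `T` the trace of `φ`. -/
structure IsH1Zero {N : ℕ} (D Γ₀ : Set (EuclideanSpace ℝ (Fin N)))
    (φ : EuclideanSpace ℝ (Fin N) → ℝ)
    (G : EuclideanSpace ℝ (Fin N) → EuclideanSpace ℝ (Fin N))
    (T : EuclideanSpace ℝ (Fin N) → ℝ) : Prop where
  isH1 : IsH1 D φ G
  hasTrace : HasTrace D φ T
  trace_zero : ∀ᵐ x ∂(μHE[N - 1].restrict Γ₀), T x = 0

/-- `∫_D ∇u · ∇φ - ∫_D f(x, u) φ - ∫_{Γ₁} g(x, u) φ`, for `u` with gradient `Du` and `φ` with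
gradient `G` and trace `T`. -/
noncomputable def weakForm {N : ℕ} (D Γ₁ : Set (EuclideanSpace ℝ (Fin N)))
    (f g : EuclideanSpace ℝ (Fin N) → ℝ → ℝ)
    (u : EuclideanSpace ℝ (Fin N) → ℝ)
    (Du : EuclideanSpace ℝ (Fin N) → EuclideanSpace ℝ (Fin N))
    (φ : EuclideanSpace ℝ (Fin N) → ℝ)
    (G : EuclideanSpace ℝ (Fin N) → EuclideanSpace ℝ (Fin N))
    (T : EuclideanSpace ℝ (Fin N) → ℝ) : ℝ :=
  (∫ x in D, inner ℝ (Du x) (G x)) - (∫ x in D, f x (u x) * φ x)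
    - ∫ x in Γ₁, g x (u x) * T x ∂μHE[N - 1]

/-! The argument is of Brezis–Oswald type. Let S be the smooth transition and θ = S(k(u - v)), a
cut-off vanishing where u ≤ v, hence on Γ₀. Test the inequality for u with vθ and the one for v with
uθ, and subtract. The boundary terms have a favourable sign because g(x,t)/t is non-increasing.
Since ∇θ = c(∇u - ∇v) with c = k S'(k(u - v)), the gradient terms combine to c(∇u - ∇v)·(v∇u - u∇v),
which is c v|∇u - ∇v|² ≥ 0 minus c(u - v)∇v·(∇u - ∇v). Dropping the square yields
`setIntegral_sub_mul_cutoff_le`: the integral of (f(x,v)u - f(x,u)v)θ is at most that of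
sS'(s)∇v·(∇u - ∇v), with s = k(u - v).

The factor sS'(s) is bounded uniformly in k and tends to 0 pointwise as k → ∞, so the right side
vanishes in the limit. On {u > v} ∩ D the factor f(x,v)u - f(x,u)v is positive, by strict
monotonicity of f(x,t)/t and v > 0, and θ grows with k. Hence already for k = 1 the left integrand
vanishes almost everywhere; {u > v} ∩ D is open and null, thus empty, and continuity gives the
closure.

Multiplying by v and u, rather than using quotients such as (u² - v²)⁺/u, makes the test functions
C¹ functions of (u, v). Their admissibility needs the chain rule `IsH1.comp_prodMk`, obtained by
mollification, and the fact that a function continuous on the closure is its own trace, which rests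
on the finiteness of the surface measure of ∂D. -/

/-! ### Mollification and weak derivatives -/

/-- The mollification of `w` by the normalized bump function `φ`. -/
noncomputable def mollify {N : ℕ} (φ : ContDiffBump (0 : EuclideanSpace ℝ (Fin N)))
    (w : EuclideanSpace ℝ (Fin N) → ℝ) : EuclideanSpace ℝ (Fin N) → ℝ :=
  convolution (φ.normed volume) w (ContinuousLinearMap.lsmul ℝ ℝ) volume

section Mollify

variable {N : ℕ} (φ : ContDiffBump (0 : EuclideanSpace ℝ (Fin N)))
  {w : EuclideanSpace ℝ (Fin N) → ℝ}

theorem mollify_apply (w : EuclideanSpace ℝ (Fin N) → ℝ) (x : EuclideanSpace ℝ (Fin N)) :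
    mollify φ w x = ∫ t, φ.normed volume (x - t) * w t := by
  simp only [mollify, convolution_lsmul_swap, smul_eq_mul]

theorem contDiff_mollify (hw : LocallyIntegrable w) : ContDiff ℝ ∞ (mollify φ w) :=
  φ.hasCompactSupport_normed.contDiff_convolution_left _ φ.contDiff_normed hw

theorem abs_mollify_le {M : ℝ} (hM : 0 ≤ M) (hw : AEStronglyMeasurable w)
    (hb : ∀ x, |w x| ≤ M) (x : EuclideanSpace ℝ (Fin N)) : |mollify φ w x| ≤ M := by
  have := dist_convolution_le (μ := volume) (g := w) (x₀ := x) (z₀ := 0) hM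
    φ.support_normed_eq.subset φ.nonneg_normed φ.integral_normed hw
    (fun y _ => by simpa using hb y)
  simpa [mollify] using this

/-- Mollification is symmetric. -/
theorem integral_mul_mollify {a g : EuclideanSpace ℝ (Fin N) → ℝ} (ha : Continuous a)
    (hac : HasCompactSupport a) (hg : Integrable g) :
    ∫ x, a x * mollify φ g x = ∫ x, mollify φ a x * g x := by
  simp only [mollify_apply, ← integral_const_mul, ← integral_mul_const]
  have hI' := hg.convolution_integrand (ContinuousLinearMap.lsmul ℝ ℝ)
    (φ.integrable_normed (μ := volume))
  obtain ⟨C, hC⟩ := hac.exists_bound_of_continuous ha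
  rw [integral_integral_swap]
  · refine integral_congr_ae (Eventually.of_forall fun y => ?_)
    refine integral_congr_ae (Eventually.of_forall fun x => ?_)
    have : φ.normed volume (y - x) = φ.normed volume (x - y) := by
      rw [← neg_sub x y, φ.normed_neg]
    simp only [this]
    ring
  · refine (hI'.bdd_mul (c := C) (f := fun p : EuclideanSpace ℝ (Fin N) × _ => a p.1)
      (ha.comp continuous_fst).aestronglyMeasurable
      (Eventually.of_forall fun p => hC p.1)).congr ?_
    refine Eventually.of_forall fun p => ?_
    simp only [Function.uncurry, ContinuousLinearMap.lsmul_apply, smul_eq_mul]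
    ring

/-- Inside the domain, the derivative of the mollification of an `H¹` function is the
mollification of its weak derivative. -/
theorem fderiv_mollify_indicator {D : Set (EuclideanSpace ℝ (Fin N))} (hD : MeasurableSet D)
    {G : EuclideanSpace ℝ (Fin N) → EuclideanSpace ℝ (Fin N)} (h : IsH1 D w G)
    (hw : LocallyIntegrable (D.indicator w)) {x : EuclideanSpace ℝ (Fin N)}
    (hx : Metric.closedBall x φ.rOut ⊆ D) (e : EuclideanSpace ℝ (Fin N)) :
    fderiv ℝ (mollify φ (D.indicator w)) x e
      = mollify φ (D.indicator fun y => inner ℝ (G y) e) x := by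
  have hφ1 : ContDiff ℝ 1 (φ.normed volume) := φ.contDiff_normed
  have hcs := φ.hasCompactSupport_normed (μ := volume)
  have hd := hcs.hasFDerivAt_convolution_left (ContinuousLinearMap.lsmul ℝ ℝ) hφ1 hw x
  have hex : ConvolutionExistsAt (fderiv ℝ (φ.normed volume)) (D.indicator w) x
      ((ContinuousLinearMap.lsmul ℝ ℝ).precompL (EuclideanSpace ℝ (Fin N))) volume :=
    (hcs.fderiv ℝ).convolutionExists_left _ (hφ1.continuous_fderiv one_ne_zero) hw x
  -- The reflected kernel centred at `x` is itself an admissible test function, being supported in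
  -- the closed ball inside `D`.
  set η : EuclideanSpace ℝ (Fin N) → ℝ := fun y => φ.normed volume (x - y) with hη
  have hηd : ContDiff ℝ ∞ η := φ.contDiff_normed.comp (contDiff_const.sub contDiff_id)
  have hsupp : Function.support η ⊆ Metric.closedBall x φ.rOut := by
    intro y hy
    have : x - y ∈ Function.support (φ.normed volume) := hy
    rw [φ.support_normed_eq, mem_ball_zero_iff] at this
    rw [Metric.mem_closedBall, dist_comm, dist_eq_norm]
    exact this.le
  have htsupp : tsupport η ⊆ Metric.closedBall x φ.rOut :=
    closure_minimal hsupp Metric.isClosed_closedBall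
  have hηc : HasCompactSupport η := (isCompact_closedBall x φ.rOut).of_isClosed_subset
    (isClosed_tsupport η) htsupp
  have hder : ∀ y, fderiv ℝ η y e = - fderiv ℝ (φ.normed volume) (x - y) e := by
    intro y
    have h1 : HasFDerivAt (fun y => x - y)
        (-ContinuousLinearMap.id ℝ (EuclideanSpace ℝ (Fin N))) y :=
      (hasFDerivAt_id y).const_sub x
    have h2 := ((hφ1.differentiable one_ne_zero) (x - y)).hasFDerivAt.comp y h1
    have h3 : fderiv ℝ η y = _ := h2.fderiv
    rw [h3]
    simp
  have hmain := h.weakGrad η hηd hηc (htsupp.trans hx) e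
  have e1 : fderiv ℝ (mollify φ (D.indicator w)) x e
      = ∫ t, fderiv ℝ (φ.normed volume) (x - t) e * D.indicator w t := by
    have : fderiv ℝ (mollify φ (D.indicator w)) x = _ := hd.fderiv
    rw [this, convolution_def, ContinuousLinearMap.integral_apply hex]
    rw [← integral_sub_left_eq_self _ volume x]
    simp
  rw [e1, mollify_apply]
  have e2 : ∫ t, fderiv ℝ (φ.normed volume) (x - t) e * D.indicator w t
      = - ∫ t in D, w t * fderiv ℝ η t e := by
    rw [← integral_indicator hD, ← integral_neg]
    refine integral_congr_ae (Eventually.of_forall fun t => ?_)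
    by_cases ht : t ∈ D <;> simp [ht, hder]
    ring
  rw [e2, hmain, neg_neg, ← integral_indicator hD]
  refine integral_congr_ae (Eventually.of_forall fun t => ?_)
  by_cases ht : t ∈ D <;> simp [ht, hη]

end Mollify

/-! ### Limits of mollified nonlinear expressions -/

section Limits

variable {N : ℕ} {φ : ℕ → ContDiffBump (0 : EuclideanSpace ℝ (Fin N))}
  {D : Set (EuclideanSpace ℝ (Fin N))} {U V : EuclideanSpace ℝ (Fin N) → ℝ} {M : ℝ}

theorem tendsto_mollify_prod (hφ : Tendsto (fun n => (φ n).rOut) atTop (𝓝 0))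
    (hU : AEStronglyMeasurable U) {x : EuclideanSpace ℝ (Fin N)} (hx : ContinuousAt U x) :
    Tendsto (fun p : ℕ × EuclideanSpace ℝ (Fin N) => mollify (φ p.1) U p.2)
      (atTop ×ˢ 𝓝 x) (𝓝 (U x)) :=
  ContDiffBump.convolution_tendsto_right (φ := fun p : ℕ × EuclideanSpace ℝ (Fin N) => φ p.1)
    (g := fun _ => U) (k := Prod.snd) (hφ.comp tendsto_fst) (Eventually.of_forall fun _ => hU)
    (hx.tendsto.comp tendsto_snd) tendsto_snd

theorem tendsto_mollify (hφ : Tendsto (fun n => (φ n).rOut) atTop (𝓝 0))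
    (hU : AEStronglyMeasurable U) {x : EuclideanSpace ℝ (Fin N)} (hx : ContinuousAt U x) :
    Tendsto (fun n => mollify (φ n) U x) atTop (𝓝 (U x)) :=
  ContDiffBump.convolution_tendsto_right (g := fun _ => U) hφ (Eventually.of_forall fun _ => hU)
    (hx.tendsto.comp tendsto_snd) tendsto_const_nhds

theorem exists_bound_on_square {B : ℝ × ℝ → ℝ} (hB : Continuous B) (M : ℝ) :
    ∃ C, 0 ≤ C ∧ ∀ s t, |s| ≤ M → |t| ≤ M → |B (s, t)| ≤ C := by
  obtain ⟨C, hC⟩ := (isCompact_Icc.prod isCompact_Icc : IsCompact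
    (Icc (-M) M ×ˢ Icc (-M) M)).exists_bound_of_continuousOn hB.continuousOn
  refine ⟨max C 0, le_max_right _ _, fun s t hs ht => (hC (s, t) ?_).trans (le_max_left _ _)⟩
  exact ⟨abs_le.1 hs, abs_le.1 ht⟩

/-- Mollifications pass to the limit in nonlinear expressions of bounded functions that are
continuous on `D`, multiplied by a mollified integrable function. -/
theorem tendsto_integral_mul_mollify (hφ : Tendsto (fun n => (φ n).rOut) atTop (𝓝 0))
    (hM : 0 ≤ M) (hU : Integrable U) (hV : Integrable V) (hUM : ∀ x, |U x| ≤ M)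
    (hVM : ∀ x, |V x| ≤ M) (hUc : ∀ x ∈ D, ContinuousAt U x) (hVc : ∀ x ∈ D, ContinuousAt V x)
    {B : ℝ × ℝ → ℝ} (hB : Continuous B) {η g : EuclideanSpace ℝ (Fin N) → ℝ}
    (hη : Continuous η) (hηc : HasCompactSupport η) (hηD : tsupport η ⊆ D) (hg : Integrable g) :
    Tendsto (fun n => ∫ x, η x * B (mollify (φ n) U x, mollify (φ n) V x) * mollify (φ n) g x)
      atTop (𝓝 (∫ x, η x * B (U x, V x) * g x)) := by
  obtain ⟨C, hC0, hC⟩ := exists_bound_on_square hB M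
  obtain ⟨C', hC'⟩ := hηc.exists_bound_of_continuous hη
  have hC'0 : 0 ≤ C' := (norm_nonneg _).trans (hC' 0)
  set a : ℕ → EuclideanSpace ℝ (Fin N) → ℝ :=
    fun n x => η x * B (mollify (φ n) U x, mollify (φ n) V x) with ha
  have hac : ∀ n, Continuous (a n) := fun n =>
    hη.mul (hB.comp ((contDiff_mollify (φ n) hU.locallyIntegrable).continuous.prodMk
      (contDiff_mollify (φ n) hV.locallyIntegrable).continuous))
  have hab : ∀ n x, |a n x| ≤ C' * C := fun n x => by
    rw [ha, abs_mul]
    exact mul_le_mul (hC' x) (hC _ _ (abs_mollify_le _ hM hU.aestronglyMeasurable hUM x)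
      (abs_mollify_le _ hM hV.aestronglyMeasurable hVM x)) (abs_nonneg _) hC'0
  -- The limit is joint in `n` and the point because `a n` will itself be mollified at scale `n`.
  -- Off the support of `η` the continuity of `U`, `V` may fail, but there `a n` vanishes nearby.
  have hlim : ∀ x, Tendsto (Function.uncurry a) (atTop ×ˢ 𝓝 x) (𝓝 (η x * B (U x, V x))) := by
    intro x
    by_cases hx : x ∈ tsupport η
    · have hp := (tendsto_mollify_prod hφ hU.aestronglyMeasurable (hUc x (hηD hx))).prodMk_nhds
        (tendsto_mollify_prod hφ hV.aestronglyMeasurable (hVc x (hηD hx)))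
      exact ((hη.tendsto x).comp tendsto_snd).mul ((hB.tendsto _).comp hp)
    · rw [image_eq_zero_of_notMem_tsupport hx, zero_mul]
      refine tendsto_const_nhds.congr' ?_
      have : ∀ᶠ y in 𝓝 x, y ∉ tsupport η := (isClosed_tsupport η).isOpen_compl.mem_nhds hx
      filter_upwards [tendsto_snd.eventually this] with p hp
      simp [Function.uncurry, ha, image_eq_zero_of_notMem_tsupport hp]
  -- Moving the mollifier from `g` to the bounded factor leaves a fixed integrable `g`, so dominated
  -- convergence applies without any L¹ convergence of mollifications.
  have hswap : ∀ n, ∫ x, a n x * mollify (φ n) g x = ∫ x, mollify (φ n) (a n) x * g x :=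
    fun n => integral_mul_mollify (φ n) (hac n) hηc.mul_right hg
  simp only [ha] at hswap ⊢
  simp only [hswap]
  refine tendsto_integral_of_dominated_convergence (fun x => C' * C * |g x|) (fun n => ?_)
    (hg.abs.const_mul _) (fun n => ?_) ?_
  · exact (contDiff_mollify (φ n)
      ((hac n).locallyIntegrable)).continuous.aestronglyMeasurable.mul hg.aestronglyMeasurable
  · refine Eventually.of_forall fun x => ?_
    rw [norm_mul]
    exact mul_le_mul_of_nonneg_right (abs_mollify_le _ (by positivity)
      (hac n).aestronglyMeasurable (hab n) x) (abs_nonneg _)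
  · refine Eventually.of_forall fun x => Tendsto.mul_const _ ?_
    exact ContDiffBump.convolution_tendsto_right hφ
      (Eventually.of_forall fun n => (hac n).aestronglyMeasurable) (hlim x) tendsto_const_nhds

end Limits

/-! ### Chain rule in H¹ -/

theorem ContinuousOn.continuousAt_indicator_of_isOpen {X : Type*} [TopologicalSpace X]
    {D : Set X} {u : X → ℝ} (hu : ContinuousOn u D) (hD : IsOpen D) {x : X} (hx : x ∈ D) :
    ContinuousAt (D.indicator u) x :=
  (hu.continuousAt (hD.mem_nhds hx)).congr
    (by filter_upwards [hD.mem_nhds hx] with y hy using (indicator_of_mem hy u).symm)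

section ChainRule

variable {N : ℕ} {D : Set (EuclideanSpace ℝ (Fin N))} {u v : EuclideanSpace ℝ (Fin N) → ℝ}
  {Du Dv : EuclideanSpace ℝ (Fin N) → EuclideanSpace ℝ (Fin N)} {M : ℝ}

theorem exists_contDiffBump_seq (N : ℕ) : ∃ φ : ℕ → ContDiffBump (0 : EuclideanSpace ℝ (Fin N)),
    Tendsto (fun n => (φ n).rOut) atTop (𝓝 0) := by
  refine ⟨fun n => ⟨1 / (n + 1) / 2, 1 / (n + 1), by positivity, half_lt_self (by positivity)⟩,
    tendsto_one_div_add_atTop_nhds_zero_nat⟩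

theorem fderiv_comp_prodMk_apply {F : ℝ × ℝ → ℝ} (hF : Differentiable ℝ F)
    {U V : EuclideanSpace ℝ (Fin N) → ℝ} {x : EuclideanSpace ℝ (Fin N)}
    (hU : DifferentiableAt ℝ U x) (hV : DifferentiableAt ℝ V x) (e : EuclideanSpace ℝ (Fin N)) :
    fderiv ℝ (fun y => F (U y, V y)) x e = fderiv ℝ F (U x, V x) (1, 0) * fderiv ℝ U x e
      + fderiv ℝ F (U x, V x) (0, 1) * fderiv ℝ V x e := by
  have h : fderiv ℝ (fun y => F (U y, V y)) x = _ :=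
    ((hF (U x, V x)).hasFDerivAt.comp x (hU.hasFDerivAt.prodMk hV.hasFDerivAt)).fderiv
  rw [h]
  have : ((fderiv ℝ U x).prod (fderiv ℝ V x)) e
      = fderiv ℝ U x e • ((1 : ℝ), (0 : ℝ)) + fderiv ℝ V x e • ((0 : ℝ), (1 : ℝ)) := by
    simp
  rw [ContinuousLinearMap.comp_apply, this, map_add, map_smul, map_smul]
  simp only [smul_eq_mul]
  ring

/-- Chain rule for a `C¹` function of two bounded `H¹` functions that are continuous in `D`. -/
theorem IsH1.comp_prodMk (hD : IsOpen D) (hDfin : volume D ≠ ⊤) (hu : IsH1 D u Du)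
    (hv : IsH1 D v Dv) (huc : ContinuousOn u D) (hvc : ContinuousOn v D)
    (huM : ∀ x ∈ D, |u x| ≤ M) (hvM : ∀ x ∈ D, |v x| ≤ M) {F : ℝ × ℝ → ℝ}
    (hF : ContDiff ℝ 1 F) :
    IsH1 D (fun x => F (u x, v x)) (fun x => fderiv ℝ F (u x, v x) (1, 0) • Du x
      + fderiv ℝ F (u x, v x) (0, 1) • Dv x) := by
  have : IsFiniteMeasure (volume.restrict D) := ⟨by simpa using hDfin.lt_top⟩
  have hDm := hD.measurableSet
  have hFd := hF.continuous_fderiv one_ne_zero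
  have hcomp : ∀ {B : ℝ × ℝ → ℝ}, Continuous B → ContinuousOn (fun x => B (u x, v x)) D :=
    fun hB => hB.comp_continuousOn (huc.prodMk hvc)
  have hmem : ∀ {B : ℝ × ℝ → ℝ}, Continuous B →
      MemLp (fun x => B (u x, v x)) ⊤ (volume.restrict D) := by
    intro B hB
    obtain ⟨C, -, hC⟩ := exists_bound_on_square hB M
    refine memLp_top_of_bound ((hcomp hB).aestronglyMeasurable hDm) C ?_
    filter_upwards [ae_restrict_mem hDm] with x hx using hC _ _ (huM x hx) (hvM x hx)
  have hF1 : Continuous fun p => fderiv ℝ F p (1, 0) := hFd.clm_apply continuous_const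
  have hF2 : Continuous fun p => fderiv ℝ F p (0, 1) := hFd.clm_apply continuous_const
  refine ⟨(hmem hF.continuous).mono_exponent le_top,
    (hu.memLp_grad.smul (hmem hF1)).add (hv.memLp_grad.smul (hmem hF2)), ?_⟩
  intro η hη hηc hηD e
  have hM : 0 ≤ max M 0 := le_max_right _ _
  have hUint : Integrable (D.indicator u) :=
    (integrable_indicator_iff hDm).2 (hu.memLp.integrable one_le_two)
  have hVint : Integrable (D.indicator v) :=
    (integrable_indicator_iff hDm).2 (hv.memLp.integrable one_le_two)
  have hgint : ∀ {G : EuclideanSpace ℝ (Fin N) → EuclideanSpace ℝ (Fin N)},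
      MemLp G 2 (volume.restrict D) → Integrable (D.indicator fun y => inner ℝ (G y) e) :=
    fun hG => (integrable_indicator_iff hDm).2 ((hG.integrable one_le_two).inner_const e)
  have hbd : ∀ {w : EuclideanSpace ℝ (Fin N) → ℝ}, (∀ x ∈ D, |w x| ≤ M) →
      ∀ x, |D.indicator w x| ≤ max M 0 := by
    intro w hw x
    by_cases hx : x ∈ D
    · simpa [hx] using Or.inl (hw x hx)
    · simp [hx]
  have hUc := fun x (hx : x ∈ D) => huc.continuousAt_indicator_of_isOpen hD hx
  have hVc := fun x (hx : x ∈ D) => hvc.continuousAt_indicator_of_isOpen hD hx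
  obtain ⟨φ, hφ⟩ := exists_contDiffBump_seq N
  set U := D.indicator u with hU
  set V := D.indicator v with hV
  have hUs := fun n => contDiff_mollify (φ n) hUint.locallyIntegrable
  have hVs := fun n => contDiff_mollify (φ n) hVint.locallyIntegrable
  have hη1 : Continuous fun x => fderiv ℝ η x e :=
    (hη.continuous_fderiv (by simp)).clm_apply continuous_const
  have hηc1 : HasCompactSupport fun x => fderiv ℝ η x e := hηc.fderiv_apply (𝕜 := ℝ) e
  have L1 := tendsto_integral_mul_mollify hφ hM hUint hVint (hbd huM) (hbd hvM) hUc hVc hF1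
    hη.continuous hηc hηD (hgint hu.memLp_grad)
  have L2 := tendsto_integral_mul_mollify hφ hM hUint hVint (hbd huM) (hbd hvM) hUc hVc hF2
    hη.continuous hηc hηD (hgint hv.memLp_grad)
  have L0 : Tendsto (fun n => ∫ x, F (mollify (φ n) U x, mollify (φ n) V x) * fderiv ℝ η x e)
      atTop (𝓝 (∫ x, F (U x, V x) * fderiv ℝ η x e)) := by
    obtain ⟨C, hC0, hC⟩ := exists_bound_on_square hF.continuous (max M 0)
    refine tendsto_integral_of_dominated_convergence (fun x => C * |fderiv ℝ η x e|)
      (fun n => ?_) ((hη1.integrable_of_hasCompactSupport hηc1).abs.const_mul C) (fun n => ?_) ?_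
    · exact ((hF.continuous.comp ((hUs n).continuous.prodMk (hVs n).continuous)).mul
        hη1).aestronglyMeasurable
    · refine Eventually.of_forall fun x => ?_
      rw [norm_mul]
      exact mul_le_mul_of_nonneg_right (hC _ _
        (abs_mollify_le _ hM hUint.aestronglyMeasurable (hbd huM) x)
        (abs_mollify_le _ hM hVint.aestronglyMeasurable (hbd hvM) x)) (abs_nonneg _)
    · refine Eventually.of_forall fun x => ?_
      by_cases hx : x ∈ tsupport η
      · exact ((hF.continuous.tendsto _).comp
          ((tendsto_mollify hφ hUint.aestronglyMeasurable (hUc x (hηD hx))).prodMk_nhds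
          (tendsto_mollify hφ hVint.aestronglyMeasurable (hVc x (hηD hx))))).mul_const _
      · have : fderiv ℝ η x = 0 :=
          image_eq_zero_of_notMem_tsupport fun h => hx (tsupport_fderiv_subset ℝ h)
        simp [this]
  have hparts : ∀ᶠ n in atTop,
      ∫ x, F (mollify (φ n) U x, mollify (φ n) V x) * fderiv ℝ η x e =
      -((∫ x, η x * fderiv ℝ F (mollify (φ n) U x, mollify (φ n) V x) (1, 0)
          * mollify (φ n) (D.indicator fun y => inner ℝ (Du y) e) x)
        + ∫ x, η x * fderiv ℝ F (mollify (φ n) U x, mollify (φ n) V x) (0, 1)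
          * mollify (φ n) (D.indicator fun y => inner ℝ (Dv y) e) x) := by
    -- Extension by zero may jump across ∂D, so the derivative formula is used only where the
    -- mollifying ball stays in `D`; compactness of the support of `η` makes this uniform.
    obtain ⟨δ, hδ, hδD⟩ := hηc.isCompact.exists_cthickening_subset_open hD hηD
    filter_upwards [hφ.eventually_lt_const hδ] with n hn
    have hFn : ContDiff ℝ 1 fun x => F (mollify (φ n) U x, mollify (φ n) V x) :=
      hF.comp (((hUs n).prodMk (hVs n)).of_le (by simp))
    have hcont : ∀ {B : ℝ × ℝ → ℝ}, Continuous B →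
        Continuous fun x => B (mollify (φ n) U x, mollify (φ n) V x) :=
      fun hB => hB.comp ((hUs n).continuous.prodMk (hVs n).continuous)
    rw [integral_mul_fderiv_eq_neg_fderiv_mul_of_integrable, ← integral_add]
    · congr 1
      refine integral_congr_ae (Eventually.of_forall fun x => ?_)
      by_cases hx : x ∈ tsupport η
      · have hball : Metric.closedBall x (φ n).rOut ⊆ D :=
          ((Metric.closedBall_subset_closedBall hn.le).trans
            (Metric.closedBall_subset_cthickening hx δ)).trans hδD
        simp only [fderiv_comp_prodMk_apply (hF.differentiable one_ne_zero)
          ((hUs n).differentiable (by simp) x) ((hVs n).differentiable (by simp) x)]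
        rw [hU, hV, fderiv_mollify_indicator (φ n) hDm hu hUint.locallyIntegrable hball,
          fderiv_mollify_indicator (φ n) hDm hv hVint.locallyIntegrable hball]
        ring
      · simp [image_eq_zero_of_notMem_tsupport hx]
    · exact ((hη.continuous.mul (hcont hF1)).mul (contDiff_mollify (φ n)
        (hgint hu.memLp_grad).locallyIntegrable).continuous).integrable_of_hasCompactSupport
        hηc.mul_right.mul_right
    · exact ((hη.continuous.mul (hcont hF2)).mul (contDiff_mollify (φ n)
        (hgint hv.memLp_grad).locallyIntegrable).continuous).integrable_of_hasCompactSupport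
        hηc.mul_right.mul_right
    · exact (((hFn.continuous_fderiv one_ne_zero).clm_apply continuous_const).mul
        hη.continuous).integrable_of_hasCompactSupport hηc.mul_left
    · exact (hFn.continuous.mul hη1).integrable_of_hasCompactSupport hηc1.mul_left
    · exact (hFn.continuous.mul hη.continuous).integrable_of_hasCompactSupport hηc.mul_left
    · exact fun x _ => hFn.differentiable one_ne_zero x
    · exact fun x _ => hη.differentiable (by simp) x
  have hlim := tendsto_nhds_unique (L0.congr' hparts) (L1.add L2).neg
  have hz : ∀ x, x ∉ D → η x = 0 := fun x hx =>
    image_eq_zero_of_notMem_tsupport fun h => hx (hηD h)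
  have hz' : ∀ x, x ∉ D → fderiv ℝ η x = 0 := fun x hx =>
    image_eq_zero_of_notMem_tsupport fun h => hx (hηD (tsupport_fderiv_subset ℝ h))
  have hi : ∀ {B : ℝ × ℝ → ℝ} {G : EuclideanSpace ℝ (Fin N) → EuclideanSpace ℝ (Fin N)},
      Continuous B → MemLp G 2 (volume.restrict D) →
      Integrable (fun x => η x * (B (u x, v x) * inner ℝ (G x) e)) (volume.restrict D) := by
    intro B G hB hG
    obtain ⟨C, hC⟩ := hηc.exists_bound_of_continuous hη.continuous
    refine Integrable.bdd_mul ?_ hη.continuous.aestronglyMeasurable (Eventually.of_forall hC)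
    obtain ⟨C', -, hC'⟩ := exists_bound_on_square hB M
    refine ((hG.integrable one_le_two).inner_const e).bdd_mul
      ((hcomp hB).aestronglyMeasurable hDm) (c := C') ?_
    filter_upwards [ae_restrict_mem hDm] with x hx using hC' _ _ (huM x hx) (hvM x hx)
  have e0 : ∫ x in D, F (u x, v x) * fderiv ℝ η x e = ∫ x, F (U x, V x) * fderiv ℝ η x e := by
    rw [← integral_indicator hDm]
    refine integral_congr_ae (Eventually.of_forall fun x => ?_)
    by_cases hx : x ∈ D <;> simp [hx, hU, hV, hz']
  have e12 : ∀ (B : ℝ × ℝ → ℝ) (G : EuclideanSpace ℝ (Fin N) → EuclideanSpace ℝ (Fin N)),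
      ∫ x, η x * B (U x, V x) * D.indicator (fun y => inner ℝ (G y) e) x
        = ∫ x in D, η x * (B (u x, v x) * inner ℝ (G x) e) := by
    intro B G
    rw [← integral_indicator hDm]
    refine integral_congr_ae (Eventually.of_forall fun x => ?_)
    by_cases hx : x ∈ D <;> simp [hx, hU, hV, mul_assoc]
  rw [e0, hlim, e12 (fun p => fderiv ℝ F p (1, 0)), e12 (fun p => fderiv ℝ F p (0, 1)),
    ← integral_add (hi hF1 hu.memLp_grad) (hi hF2 hv.memLp_grad)]
  congr 1
  refine integral_congr_ae (Eventually.of_forall fun x => ?_)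
  simp only [inner_add_left, real_inner_smul_left]
  ring

end ChainRule

/-! ### Surface measure and traces -/

section SurfaceMeasure

open Module

variable {N : ℕ} {D : Set (EuclideanSpace ℝ (Fin N))}

/-- Points above the graph lie in `D`, which is open and so misses its frontier; points strictly
below have a neighbourhood missing `D`. -/
theorem mem_frontier_eq_graph {x e y : EuclideanSpace ℝ (Fin N)} {r : ℝ}
    {h : EuclideanSpace ℝ (Fin N) → ℝ} (hD : IsOpen D) (hh : Continuous h)
    (hgraph : ∀ y ∈ Metric.ball x r, (y ∈ D ↔ h (y - inner ℝ e y • e) < inner ℝ e y))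
    (hy : y ∈ Metric.ball x r) (hyD : y ∈ frontier D) :
    h (y - inner ℝ e y • e) = inner ℝ e y := by
  have hnD : y ∉ D := by rw [hD.frontier_eq] at hyD; exact hyD.2
  refine le_antisymm ?_ (not_lt.1 fun hlt => hnD ((hgraph y hy).2 hlt))
  by_contra! hlt
  have hinner : Continuous fun z : EuclideanSpace ℝ (Fin N) => (inner ℝ e z : ℝ) :=
    continuous_const.inner continuous_id
  have hopen : IsOpen {z | (inner ℝ e z : ℝ) < h (z - inner ℝ e z • e)} :=
    isOpen_lt hinner (hh.comp (continuous_id.sub (hinner.smul continuous_const)))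
  obtain ⟨z, hz, hzD⟩ := mem_closure_iff_nhds.1 (frontier_subset_closure hyD) _
    (inter_mem (hopen.mem_nhds hlt) (Metric.isOpen_ball.mem_nhds hy))
  exact lt_asymm hz.1 ((hgraph z hz.2).1 hzD)

/-- Locally ∂D lies in the image of a bounded piece of the hyperplane orthogonal to `e` under the
graph map. This map is locally Lipschitz, and on the hyperplane the Hausdorff measure of matching
dimension is finite on compact sets. -/
theorem finiteAtFilter_frontier (hD : IsOpen D) (hs : HasSmoothBoundary D)
    {x : EuclideanSpace ℝ (Fin N)} (hx : x ∈ frontier D) :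
    (μHE[N - 1] : Measure (EuclideanSpace ℝ (Fin N))).FiniteAtFilter (𝓝[frontier D] x) := by
  obtain ⟨r, hr, e, he, h, hh, hgraph⟩ := hs x hx
  have hee : (inner ℝ e e : ℝ) = 1 := by rw [real_inner_self_eq_norm_sq, he]; norm_num
  have he0 : e ≠ 0 := by rintro rfl; simp at he
  set S : Submodule ℝ (EuclideanSpace ℝ (Fin N)) := (ℝ ∙ e)ᗮ with hS
  have hrank : finrank ℝ S = N - 1 := by
    have := (ℝ ∙ e).finrank_add_finrank_orthogonal
    rw [finrank_span_singleton he0, finrank_euclideanSpace_fin] at this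
    exact (Nat.sub_eq_of_eq_add' this.symm).symm
  have hP : ∀ y : EuclideanSpace ℝ (Fin N), y - (inner ℝ e y : ℝ) • e ∈ S := by
    intro y
    rw [hS, Submodule.mem_orthogonal_singleton_iff_inner_right, inner_sub_right,
      real_inner_smul_right, hee, mul_one, sub_self]
  set P : EuclideanSpace ℝ (Fin N) → S := fun y => ⟨y - (inner ℝ e y : ℝ) • e, hP y⟩ with hPdef
  have hPc : Continuous P := by
    refine Continuous.subtype_mk ?_ _
    fun_prop
  set Φ : S → EuclideanSpace ℝ (Fin N) := fun z => z + h z • e with hΦ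
  have hΦd : ContDiff ℝ 1 Φ := by
    have h1 : ContDiff ℝ 1 (fun z : S => (z : EuclideanSpace ℝ (Fin N))) := S.subtypeL.contDiff
    exact h1.add (((hh.of_le (by simp)).comp h1).smul contDiff_const)
  obtain ⟨K, t, ht, hK⟩ := hΦd.contDiffAt.exists_lipschitzOnWith (x := P x)
  -- The Lipschitz neighbourhood may be unbounded, hence the intersection with a compact ball.
  set t' := t ∩ Metric.closedBall (P x) 1 with ht'
  have ht'n : t' ∈ 𝓝 (P x) := inter_mem ht (Metric.closedBall_mem_nhds _ one_pos)
  refine ⟨frontier D ∩ (Metric.ball x r ∩ P ⁻¹' t'), inter_mem self_mem_nhdsWithin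
    (mem_nhdsWithin_of_mem_nhds (inter_mem (Metric.ball_mem_nhds x hr)
      (hPc.continuousAt.preimage_mem_nhds ht'n))), ?_⟩
  have hsub : frontier D ∩ (Metric.ball x r ∩ P ⁻¹' t') ⊆ Φ '' t' := by
    rintro y ⟨hyD, hyb, hyt⟩
    refine ⟨P y, hyt, ?_⟩
    simp only [hΦ, hPdef]
    rw [mem_frontier_eq_graph hD hh.continuous hgraph hyb hyD]
    simp
  refine (measure_mono hsub).trans_lt ?_
  rw [Measure.euclideanHausdorffMeasure_def, Measure.smul_apply, ENNReal.smul_def, smul_eq_mul]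
  refine ENNReal.mul_lt_top ENNReal.coe_lt_top ?_
  refine ((hK.mono inter_subset_left).hausdorffMeasure_image_le (Nat.cast_nonneg _)).trans_lt ?_
  refine ENNReal.mul_lt_top (by simp) ?_
  rw [← hrank]
  exact (measure_mono inter_subset_right).trans_lt
    (isCompact_closedBall (P x) 1).measure_lt_top

/-- The boundary of a bounded smooth domain has finite surface measure. -/
theorem euclideanHausdorffMeasure_frontier_lt_top (hD : IsSmoothBoundedDomain D) :
    (μHE[N - 1] : Measure (EuclideanSpace ℝ (Fin N))) (frontier D) < ⊤ :=
  (hD.isBounded.isCompact_closure.of_isClosed_subset isClosed_frontier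
    frontier_subset_closure).measure_lt_top_of_nhdsWithin
    fun _ hx => finiteAtFilter_frontier hD.isOpen hD.smoothBoundary hx

/-- A function that is continuous up to the boundary is its own trace. -/
theorem hasTrace_of_continuousOn (hD : IsSmoothBoundedDomain D)
    {w : EuclideanSpace ℝ (Fin N) → ℝ} (hw : ContinuousOn w (closure D)) : HasTrace D w w := by
  have hfin : IsFiniteMeasure
      ((μHE[N - 1] : Measure (EuclideanSpace ℝ (Fin N))).restrict (frontier D)) :=
    ⟨by simpa using euclideanHausdorffMeasure_frontier_lt_top hD⟩
  obtain ⟨C, hC⟩ := hD.isBounded.isCompact_closure.exists_bound_of_continuousOn hw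
  have hm : MeasurableSet (frontier D) := isClosed_frontier.measurableSet
  refine ⟨(memLp_top_of_bound ((hw.mono frontier_subset_closure).aestronglyMeasurable hm) C
    ?_).mono_exponent le_top, ?_⟩
  · filter_upwards [ae_restrict_mem hm] with x hx using hC x (frontier_subset_closure hx)
  filter_upwards [ae_restrict_mem hm] with x hx
  rw [Metric.tendsto_nhdsWithin_nhds]
  intro ε hε
  obtain ⟨δ, hδ, hδw⟩ := Metric.continuousOn_iff.1 hw x (frontier_subset_closure hx) (ε / 2)
    (half_pos hε)
  refine ⟨δ, hδ, fun {r} hr hrδ => ?_⟩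
  have hr0 : 0 < r := hr
  rw [Real.dist_eq, sub_zero, abs_of_pos hr0] at hrδ
  have hvol : volume (D ∩ Metric.ball x r) < ⊤ :=
    (measure_mono inter_subset_right).trans_lt Metric.isBounded_ball.measure_lt_top
  rw [Real.dist_eq, sub_zero, setAverage_eq, smul_eq_mul, abs_mul, abs_inv,
    abs_of_nonneg measureReal_nonneg]
  have hb : |(∫ y in D ∩ Metric.ball x r, |w y - w x|)|
      ≤ ε / 2 * volume.real (D ∩ Metric.ball x r) := by
    rw [← Real.norm_eq_abs]
    refine norm_setIntegral_le_of_norm_le_const hvol fun y hy => ?_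
    rw [Real.norm_eq_abs, abs_abs]
    exact (hδw y (subset_closure hy.1) ((Metric.mem_ball.1 hy.2).trans hrδ)).le
  -- If `D ∩ ball x r` were null, the average would be 0 by convention, so no lower volume bound is
  -- needed.
  rcases (measureReal_nonneg (μ := volume) (s := D ∩ Metric.ball x r)).eq_or_lt with h0 | h0
  · rw [← h0]; simpa using hε
  · rw [inv_mul_lt_iff₀ h0]
    nlinarith

end SurfaceMeasure

/-! ### Integrability and admissible test functions -/

theorem MeasureTheory.MemLp.integrable_real_inner {X E : Type*} [MeasurableSpace X]
    {μ : Measure X} [NormedAddCommGroup E] [InnerProductSpace ℝ E] {p q : X → E}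
    (hp : MemLp p 2 μ) (hq : MemLp q 2 μ) : Integrable (fun x => (inner ℝ (p x) (q x) : ℝ)) μ :=
  (hp.norm.integrable_mul hq.norm).mono'
    (hp.aestronglyMeasurable.inner hq.aestronglyMeasurable)
    (Eventually.of_forall fun x => norm_inner_le_norm (p x) (q x))

section TestFunctions

variable {N : ℕ} {D Γ₀ Γ₁ : Set (EuclideanSpace ℝ (Fin N))} {u v : EuclideanSpace ℝ (Fin N) → ℝ}
  {Du Dv : EuclideanSpace ℝ (Fin N) → EuclideanSpace ℝ (Fin N)}

theorem ContinuousOn.integrableOn_of_subset {X : Type*} [TopologicalSpace X] [T2Space X]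
    [MeasurableSpace X] [BorelSpace X] [SecondCountableTopology X] {K S : Set X}
    {h : X → ℝ} {μ : Measure X} (hh : ContinuousOn h K) (hK : IsCompact K) (hSK : S ⊆ K)
    (hS : MeasurableSet S) (hμ : μ S < ⊤) : IntegrableOn h S μ := by
  obtain ⟨C, hC⟩ := hK.exists_bound_of_continuousOn hh
  have : IsFiniteMeasure (μ.restrict S) := ⟨by simpa using hμ⟩
  refine Integrable.of_bound ((hh.mono hSK).aestronglyMeasurable hS) C ?_
  filter_upwards [ae_restrict_mem hS] with x hx using hC x (hSK hx)

/-- `C¹` functions of two `H¹` functions continuous on the closure, vanishing on `Γ₀`, are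
admissible test functions. -/
theorem isH1Zero_comp_prodMk (hD : IsSmoothBoundedDomain D) (hΓ₀ : MeasurableSet Γ₀)
    (hu : IsH1 D u Du) (hv : IsH1 D v Dv) (huc : ContinuousOn u (closure D))
    (hvc : ContinuousOn v (closure D)) {F : ℝ × ℝ → ℝ} (hF : ContDiff ℝ 1 F)
    (hF0 : ∀ x ∈ Γ₀, F (u x, v x) = 0) :
    IsH1Zero D Γ₀ (fun x => F (u x, v x)) (fun x => fderiv ℝ F (u x, v x) (1, 0) • Du x
      + fderiv ℝ F (u x, v x) (0, 1) • Dv x) (fun x => F (u x, v x)) := by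
  obtain ⟨A, hA⟩ := hD.isBounded.isCompact_closure.exists_bound_of_continuousOn huc
  obtain ⟨B, hB⟩ := hD.isBounded.isCompact_closure.exists_bound_of_continuousOn hvc
  refine ⟨hu.comp_prodMk (M := max A B) hD.isOpen hD.isBounded.measure_lt_top.ne hv
    (huc.mono subset_closure) (hvc.mono subset_closure)
    (fun x hx => (hA x (subset_closure hx)).trans (le_max_left _ _))
    (fun x hx => (hB x (subset_closure hx)).trans (le_max_right _ _)) hF,
    hasTrace_of_continuousOn hD (hF.continuous.comp_continuousOn (huc.prodMk hvc)), ?_⟩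
  filter_upwards [ae_restrict_mem hΓ₀] with x hx using hF0 x hx

end TestFunctions

/-! ### The cut-off and its derivative -/

section Transition

open Real

theorem deriv_smoothTransition_nonneg (s : ℝ) : 0 ≤ deriv smoothTransition s :=
  smoothTransition.monotone.deriv_nonneg

theorem deriv_smoothTransition_of_neg {s : ℝ} (hs : s < 0) : deriv smoothTransition s = 0 := by
  have : smoothTransition =ᶠ[𝓝 s] fun _ => 0 := by
    filter_upwards [gt_mem_nhds hs] with t ht using smoothTransition.zero_of_nonpos ht.le
  rw [this.deriv_eq, deriv_const]

theorem deriv_smoothTransition_of_one_lt {s : ℝ} (hs : 1 < s) :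
    deriv smoothTransition s = 0 := by
  have : smoothTransition =ᶠ[𝓝 s] fun _ => 1 := by
    filter_upwards [lt_mem_nhds hs] with t ht using smoothTransition.one_of_one_le ht.le
  rw [this.deriv_eq, deriv_const]

theorem continuous_deriv_smoothTransition : Continuous (deriv smoothTransition) :=
  (smoothTransition.contDiff (n := 1)).continuous_deriv le_rfl

theorem exists_bound_mul_deriv_smoothTransition :
    ∃ C, ∀ s, |s * deriv smoothTransition s| ≤ C := by
  obtain ⟨C, hC⟩ := (isCompact_Icc (a := (0 : ℝ)) (b := 1)).exists_bound_of_continuousOn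
    (continuous_id.mul continuous_deriv_smoothTransition).continuousOn
  refine ⟨C, fun s => ?_⟩
  have hC0 : 0 ≤ C := (norm_nonneg _).trans (hC 0 (by simp))
  rcases lt_or_ge s 0 with h | h
  · simpa [deriv_smoothTransition_of_neg h] using hC0
  rcases lt_or_ge 1 s with h' | h'
  · simpa [deriv_smoothTransition_of_one_lt h'] using hC0
  · exact hC s ⟨h, h'⟩

/-- The derivative of the transition vanishes off [0, 1], and for `s ≠ 0` the multiples (n + 1)s
eventually leave this interval; for `s = 0` the first factor vanishes. -/
theorem tendsto_mul_deriv_smoothTransition (s : ℝ) :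
    Tendsto (fun n : ℕ => ((n + 1) * s) * deriv smoothTransition ((n + 1) * s)) atTop (𝓝 0) := by
  refine tendsto_const_nhds.congr' ?_
  rcases lt_trichotomy s 0 with h | h | h
  · refine Eventually.of_forall fun n => ?_
    have hn : ((n : ℝ) + 1) * s < 0 := mul_neg_of_pos_of_neg (by positivity) h
    simp only [deriv_smoothTransition_of_neg hn, mul_zero]
  · simp [h]
  · have : Tendsto (fun n : ℕ => ((n : ℝ) + 1) * s) atTop atTop :=
      (tendsto_atTop_add_const_right _ _ tendsto_natCast_atTop_atTop).atTop_mul_const h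
    filter_upwards [this.eventually_gt_atTop 1] with n hn
    simp only [deriv_smoothTransition_of_one_lt hn, mul_zero]

theorem hasFDerivAt_smoothTransition_mul_sub (k : ℝ) (p : ℝ × ℝ) :
    HasFDerivAt (fun p : ℝ × ℝ => smoothTransition (k * (p.1 - p.2)))
      (deriv smoothTransition (k * (p.1 - p.2)) •
        (k • (ContinuousLinearMap.fst ℝ ℝ ℝ - ContinuousLinearMap.snd ℝ ℝ ℝ))) p := by
  have h1 : HasDerivAt smoothTransition (deriv smoothTransition (k * (p.1 - p.2)))
      (k * (p.1 - p.2)) :=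
    ((smoothTransition.contDiff (n := 1)).differentiable one_ne_zero _).hasDerivAt
  have h2 : HasFDerivAt (fun p : ℝ × ℝ => k * (p.1 - p.2))
      (k • (ContinuousLinearMap.fst ℝ ℝ ℝ - ContinuousLinearMap.snd ℝ ℝ ℝ)) p :=
    (k • (ContinuousLinearMap.fst ℝ ℝ ℝ - ContinuousLinearMap.snd ℝ ℝ ℝ)).hasFDerivAt
  exact h1.comp_hasFDerivAt p h2

theorem contDiff_smoothTransition_mul_sub (k : ℝ) :
    ContDiff ℝ 1 (fun p : ℝ × ℝ => smoothTransition (k * (p.1 - p.2))) :=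
  (smoothTransition.contDiff (n := 1)).comp
    (contDiff_const.mul (contDiff_fst.sub contDiff_snd))

theorem fderiv_fst_mul_smoothTransition (k a b : ℝ) (q : ℝ × ℝ) :
    fderiv ℝ (fun p : ℝ × ℝ => p.1 * smoothTransition (k * (p.1 - p.2))) (a, b) q
      = smoothTransition (k * (a - b)) * q.1
        + a * (deriv smoothTransition (k * (a - b)) * (k * (q.1 - q.2))) := by
  have h : fderiv ℝ (fun p : ℝ × ℝ => p.1 * smoothTransition (k * (p.1 - p.2))) (a, b) = _ :=
    (hasFDerivAt_fst.mul (hasFDerivAt_smoothTransition_mul_sub k (a, b))).fderiv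
  rw [h]
  simp
  ring

theorem fderiv_snd_mul_smoothTransition (k a b : ℝ) (q : ℝ × ℝ) :
    fderiv ℝ (fun p : ℝ × ℝ => p.2 * smoothTransition (k * (p.1 - p.2))) (a, b) q
      = smoothTransition (k * (a - b)) * q.2
        + b * (deriv smoothTransition (k * (a - b)) * (k * (q.1 - q.2))) := by
  have h : fderiv ℝ (fun p : ℝ × ℝ => p.2 * smoothTransition (k * (p.1 - p.2))) (a, b) = _ :=
    (hasFDerivAt_snd.mul (hasFDerivAt_smoothTransition_mul_sub k (a, b))).fderiv
  rw [h]
  simp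
  ring

end Transition

/-! ### Pointwise inequalities -/

/-- For 0 < t < 1 monotonicity gives h(t) ≥ t h(1); let t → 0. -/
theorem nonneg_of_antitoneOn_div {h : ℝ → ℝ} (hc : ContinuousOn h (Ici 0))
    (hh : AntitoneOn (fun t => h t / t) (Ioi 0)) : 0 ≤ h 0 := by
  have h1 : Tendsto (fun t : ℝ => t * h 1) (𝓝[>] 0) (𝓝 0) := by
    have : Tendsto (fun t : ℝ => t * h 1) (𝓝 0) (𝓝 (0 * h 1)) := tendsto_id.mul_const _
    rw [zero_mul] at this
    exact this.mono_left nhdsWithin_le_nhds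
  have h2 : Tendsto h (𝓝[>] 0) (𝓝 (h 0)) :=
    (hc 0 self_mem_Ici).mono_left (nhdsWithin_mono _ Ioi_subset_Ici_self)
  refine le_of_tendsto_of_tendsto h1 h2 ?_
  filter_upwards [Ioo_mem_nhdsGT (zero_lt_one' ℝ)] with t ht
  have := hh (mem_Ioi.2 ht.1) (mem_Ioi.2 one_pos) ht.2.le
  simp only [div_one] at this
  rw [le_div_iff₀ ht.1] at this
  linarith

/-- The cross-multiplied form allows `b = 0`, which is needed on Γ₁, where v is only known to be
non-negative. -/
theorem mul_le_mul_of_antitoneOn_div {h : ℝ → ℝ} (hc : ContinuousOn h (Ici 0))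
    (hh : AntitoneOn (fun t => h t / t) (Ioi 0)) {a b : ℝ} (hb : 0 ≤ b) (hab : b ≤ a) :
    h a * b ≤ h b * a := by
  rcases hb.eq_or_lt with rfl | hb
  · simpa using mul_nonneg (nonneg_of_antitoneOn_div hc hh) hab
  · have ha := hb.trans_le hab
    exact (div_le_div_iff₀ ha hb).1 (hh (mem_Ioi.2 hb) (mem_Ioi.2 ha) hab)

/-- The key pointwise inequality behind the Brezis–Oswald type argument: `c ≥ 0` stands for the
derivative of the cut-off and `θ` for its value. -/
theorem inner_test_sub_ge {E : Type*} [NormedAddCommGroup E] [InnerProductSpace ℝ E] (X Y : E)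
    {a b c : ℝ} (θ : ℝ) (hb : 0 ≤ b) (hc : 0 ≤ c) :
    c * (a - b) * inner ℝ Y (Y - X) ≤ inner ℝ X ((b * c) • X + (θ - b * c) • Y)
      - inner ℝ Y ((θ + a * c) • X + (-(a * c)) • Y) := by
  have hXX : 0 ≤ (inner ℝ (X - Y) (X - Y) : ℝ) := real_inner_self_nonneg
  simp only [inner_sub_left, inner_sub_right, inner_add_right, real_inner_smul_right] at hXX ⊢
  rw [real_inner_comm X Y] at *
  -- The `θ` terms cancel by symmetry of the inner product, and bX - aY = b(X - Y) + (b - a)Y; the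
  -- discarded term is bc|X - Y|².
  nlinarith [mul_nonneg (mul_nonneg hb hc) hXX]

/-! ### The integral inequality and the comparison -/

section Main

variable {N : ℕ} {D Γ₀ Γ₁ : Set (EuclideanSpace ℝ (Fin N))}
  {f g : EuclideanSpace ℝ (Fin N) → ℝ → ℝ} {u v : EuclideanSpace ℝ (Fin N) → ℝ}
  {Du Dv : EuclideanSpace ℝ (Fin N) → EuclideanSpace ℝ (Fin N)}

/-- Dominated convergence: s S'(s) is bounded independently of `n` and tends to 0 pointwise, so
integrability of `ψ` suffices. -/
theorem tendsto_integral_mul_deriv_smoothTransition (hD : MeasurableSet D) {w ψ :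
    EuclideanSpace ℝ (Fin N) → ℝ} (hw : ContinuousOn w D) (hψ : IntegrableOn ψ D) :
    Tendsto (fun n : ℕ => ∫ x in D, ((n + 1) * w x) *
      deriv Real.smoothTransition ((n + 1) * w x) * ψ x) atTop (𝓝 0) := by
  obtain ⟨C, hC⟩ := exists_bound_mul_deriv_smoothTransition
  have h0 : ∫ x in D, (0 : ℝ) = 0 := integral_zero _ _
  rw [← h0]
  refine tendsto_integral_of_dominated_convergence (fun x => C * |ψ x|) (fun n => ?_)
    (hψ.abs.const_mul C) (fun n => ?_) ?_
  · refine AEStronglyMeasurable.mul ?_ hψ.aestronglyMeasurable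
    exact ((continuous_id.mul continuous_deriv_smoothTransition).comp_continuousOn
      (continuousOn_const.mul hw)).aestronglyMeasurable hD
  · refine Eventually.of_forall fun x => ?_
    rw [norm_mul]
    exact mul_le_mul_of_nonneg_right (hC _) (abs_nonneg _)
  · refine Eventually.of_forall fun x => ?_
    simpa using (tendsto_mul_deriv_smoothTransition (w x)).mul_const (ψ x)

/-- Testing the inequalities for `u` and `v` with `v θ` and `u θ`, where `θ` is a cut-off of
`u - v`. -/
theorem setIntegral_sub_mul_cutoff_le (hD : IsSmoothBoundedDomain D)
    (hΓ : IsBoundarySplitting D Γ₀ Γ₁)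
    (hf : ContinuousOn (fun p : EuclideanSpace ℝ (Fin N) × ℝ => f p.1 p.2)
      (closure D ×ˢ Ici 0))
    (hg : ContinuousOn (fun p : EuclideanSpace ℝ (Fin N) × ℝ => g p.1 p.2)
      (closure Γ₁ ×ˢ Ici 0))
    (hg_dec : ∀ x ∈ Γ₁, AntitoneOn (fun t => g x t / t) (Ioi 0))
    (hu : IsH1 D u Du) (hv : IsH1 D v Dv)
    (huc : ContinuousOn u (closure D)) (hvc : ContinuousOn v (closure D))
    (hu0 : ∀ x ∈ closure D, 0 ≤ u x) (hv0 : ∀ x ∈ closure D, 0 ≤ v x)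
    (huv : ∀ x ∈ Γ₀, u x ≤ v x)
    (hu_sub : ∀ φ G T, IsH1Zero D Γ₀ φ G T → (∀ᵐ x ∂(volume.restrict D), 0 ≤ φ x) →
      weakForm D Γ₁ f g u Du φ G T ≤ 0)
    (hv_super : ∀ φ G T, IsH1Zero D Γ₀ φ G T → (∀ᵐ x ∂(volume.restrict D), 0 ≤ φ x) →
      0 ≤ weakForm D Γ₁ f g v Dv φ G T) {k : ℝ} (hk : 0 ≤ k) :
    ∫ x in D, (f x (v x) * u x - f x (u x) * v x) * Real.smoothTransition (k * (u x - v x))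
      ≤ ∫ x in D, (k * (u x - v x)) * deriv Real.smoothTransition (k * (u x - v x))
        * inner ℝ (Dv x) (Du x - Dv x) := by
  have hDm := hD.isOpen.measurableSet
  have hKc := hD.isBounded.isCompact_closure
  have hΓ₀m : MeasurableSet Γ₀ := by
    obtain ⟨U, hU, rfl⟩ := hΓ.relOpen₀
    exact hU.measurableSet.inter isClosed_frontier.measurableSet
  have hΓ₁m : MeasurableSet Γ₁ := by
    obtain ⟨U, hU, rfl⟩ := hΓ.relOpen₁
    exact hU.measurableSet.inter isClosed_frontier.measurableSet
  have hΓ₁f : Γ₁ ⊆ frontier D := by rw [hΓ.cover]; exact subset_union_right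
  have hΓ₁K : closure Γ₁ ⊆ closure D :=
    (closure_minimal hΓ₁f isClosed_frontier).trans frontier_subset_closure
  have hDfin : volume D < ⊤ := hD.isBounded.measure_lt_top
  have hΓfin : (μHE[N - 1] : Measure (EuclideanSpace ℝ (Fin N))) Γ₁ < ⊤ :=
    (measure_mono hΓ₁f).trans_lt (euclideanHausdorffMeasure_frontier_lt_top hD)
  set θ : EuclideanSpace ℝ (Fin N) → ℝ := fun x => Real.smoothTransition (k * (u x - v x))
    with hθ
  set θ' : EuclideanSpace ℝ (Fin N) → ℝ :=
    fun x => deriv Real.smoothTransition (k * (u x - v x)) with hθ'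
  have hθ0 : ∀ x, 0 ≤ θ x := fun x => Real.smoothTransition.nonneg _
  have hθc : ContinuousOn θ (closure D) :=
    Real.smoothTransition.continuous.comp_continuousOn (continuousOn_const.mul (huc.sub hvc))
  have hθ_zero : ∀ x, u x ≤ v x → θ x = 0 := fun x hx =>
    Real.smoothTransition.zero_of_nonpos (mul_nonpos_of_nonneg_of_nonpos hk (sub_nonpos.2 hx))
  have hφ := isH1Zero_comp_prodMk hD hΓ₀m hu hv huc hvc
    (contDiff_snd.mul (contDiff_smoothTransition_mul_sub k))
    (fun x hx => by rw [show Real.smoothTransition (k * (u x - v x)) = 0 from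
      hθ_zero x (huv x hx), mul_zero])
  have hψ := isH1Zero_comp_prodMk hD hΓ₀m hu hv huc hvc
    (contDiff_fst.mul (contDiff_smoothTransition_mul_sub k))
    (fun x hx => by rw [show Real.smoothTransition (k * (u x - v x)) = 0 from
      hθ_zero x (huv x hx), mul_zero])
  have hsub := hu_sub _ _ _ hφ (by
    filter_upwards [ae_restrict_mem hDm] with x hx
    exact mul_nonneg (hv0 x (subset_closure hx)) (hθ0 x))
  have hsup := hv_super _ _ _ hψ (by
    filter_upwards [ae_restrict_mem hDm] with x hx
    exact mul_nonneg (hu0 x (subset_closure hx)) (hθ0 x))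
  have hIφ := MemLp.integrable_real_inner hu.memLp_grad hφ.isH1.memLp_grad
  have hIψ := MemLp.integrable_real_inner hv.memLp_grad hψ.isH1.memLp_grad
  have hfw : ∀ {w : EuclideanSpace ℝ (Fin N) → ℝ}, ContinuousOn w (closure D) →
      (∀ x ∈ closure D, 0 ≤ w x) → ContinuousOn (fun x => f x (w x)) (closure D) :=
    fun hw hw0 => hf.comp (continuousOn_id.prodMk hw) fun x hx => ⟨hx, hw0 x hx⟩
  have hgw : ∀ {w : EuclideanSpace ℝ (Fin N) → ℝ}, ContinuousOn w (closure D) →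
      (∀ x ∈ closure D, 0 ≤ w x) → ContinuousOn (fun x => g x (w x)) (closure Γ₁) :=
    fun hw hw0 => hg.comp (continuousOn_id.prodMk (hw.mono hΓ₁K))
      fun x hx => ⟨hx, hw0 x (hΓ₁K hx)⟩
  have hIf : ∀ {w z : EuclideanSpace ℝ (Fin N) → ℝ}, ContinuousOn w (closure D) →
      (∀ x ∈ closure D, 0 ≤ w x) → ContinuousOn z (closure D) →
      IntegrableOn (fun x => f x (w x) * (z x * θ x)) D := fun hw hw0 hz =>
    ((hfw hw hw0).mul (hz.mul hθc)).integrableOn_of_subset hKc subset_closure hDm hDfin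
  have hIg : ∀ {w z : EuclideanSpace ℝ (Fin N) → ℝ}, ContinuousOn w (closure D) →
      (∀ x ∈ closure D, 0 ≤ w x) → ContinuousOn z (closure D) →
      IntegrableOn (fun x => g x (w x) * (z x * θ x)) Γ₁ μHE[N - 1] := fun hw hw0 hz =>
    ((hgw hw hw0).mul ((hz.mul hθc).mono hΓ₁K)).integrableOn_of_subset
      (hKc.of_isClosed_subset isClosed_closure hΓ₁K) subset_closure hΓ₁m hΓfin
  have hbdry : ∫ x in Γ₁, g x (u x) * (v x * θ x) ∂μHE[N - 1]
      ≤ ∫ x in Γ₁, g x (v x) * (u x * θ x) ∂μHE[N - 1] := by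
    refine setIntegral_mono_on (hIg huc hu0 hvc) (hIg hvc hv0 huc) hΓ₁m fun x hx => ?_
    have hxD := hΓ₁K (subset_closure hx)
    rcases le_total (u x) (v x) with h | h
    · simp [hθ_zero x h]
    · have hgx : ContinuousOn (g x) (Ici 0) :=
        hg.comp (continuousOn_const.prodMk continuousOn_id) fun t ht => ⟨subset_closure hx, ht⟩
      rw [← mul_assoc, ← mul_assoc]
      exact mul_le_mul_of_nonneg_right
        (mul_le_mul_of_antitoneOn_div hgx (hg_dec x hx) (hv0 x hxD) h) (hθ0 x)
  have hgrad : -∫ x in D, (k * (u x - v x)) * θ' x * inner ℝ (Dv x) (Du x - Dv x) ≤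
      (∫ x in D, inner ℝ (Du x) (fderiv ℝ (fun p : ℝ × ℝ => p.2 *
          Real.smoothTransition (k * (p.1 - p.2))) (u x, v x) (1, 0) • Du x
        + fderiv ℝ (fun p : ℝ × ℝ => p.2 *
          Real.smoothTransition (k * (p.1 - p.2))) (u x, v x) (0, 1) • Dv x))
      - ∫ x in D, inner ℝ (Dv x) (fderiv ℝ (fun p : ℝ × ℝ => p.1 *
          Real.smoothTransition (k * (p.1 - p.2))) (u x, v x) (1, 0) • Du x
        + fderiv ℝ (fun p : ℝ × ℝ => p.1 *
          Real.smoothTransition (k * (p.1 - p.2))) (u x, v x) (0, 1) • Dv x) := by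
    rw [← integral_sub hIφ hIψ, ← integral_neg]
    refine setIntegral_mono_on ?_ (hIφ.sub hIψ) hDm fun x hx => ?_
    · obtain ⟨C, hC⟩ := exists_bound_mul_deriv_smoothTransition
      refine Integrable.neg ((MemLp.integrable_real_inner hv.memLp_grad
        (hu.memLp_grad.sub hv.memLp_grad)).bdd_mul (c := C) ?_
        (Eventually.of_forall fun x => hC _))
      exact ((continuous_id.mul continuous_deriv_smoothTransition).comp_continuousOn
        (continuousOn_const.mul ((huc.sub hvc).mono subset_closure))).aestronglyMeasurable hDm
    -- With c = k S'(k(u - v)) one has ∇θ = c(∇u - ∇v), so the two combinations in the lemma are the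
    -- gradients of vθ and uθ.
    · have := inner_test_sub_ge (Du x) (Dv x) (a := u x) (b := v x) (c := k * θ' x) (θ x)
        (hv0 x (subset_closure hx)) (mul_nonneg hk (deriv_smoothTransition_nonneg _))
      rw [← neg_sub (Du x) (Dv x), inner_neg_right] at this
      refine le_trans (le_of_eq ?_) (this.trans (le_of_eq ?_))
      · ring
      · simp only [fderiv_fst_mul_smoothTransition, fderiv_snd_mul_smoothTransition, hθ, hθ']
        ring_nf
  have hsplit : ∫ x in D, (f x (v x) * u x - f x (u x) * v x) * θ x
      = (∫ x in D, f x (v x) * (u x * θ x)) - ∫ x in D, f x (u x) * (v x * θ x) := by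
    rw [← integral_sub (hIf hvc hv0 huc) (hIf huc hu0 hvc)]
    congr 1 with x
    ring
  simp only [weakForm] at hsub hsup
  rw [hsplit]
  simp only [hθ, hθ'] at *
  linarith

end Main


theorem propositionA1 {N : ℕ} (hN : 2 ≤ N)
    (D Γ₀ Γ₁ : Set (EuclideanSpace ℝ (Fin N)))
    (hD : IsSmoothBoundedDomain D) (hΓ : IsBoundarySplitting D Γ₀ Γ₁)
    (f g : EuclideanSpace ℝ (Fin N) → ℝ → ℝ)
    (hf : ContinuousOn (fun p : EuclideanSpace ℝ (Fin N) × ℝ => f p.1 p.2)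
      (closure D ×ˢ Ici 0))
    (hg : ContinuousOn (fun p : EuclideanSpace ℝ (Fin N) × ℝ => g p.1 p.2)
      (closure Γ₁ ×ˢ Ici 0))
    (hf_dec : ∀ x ∈ D, StrictAntiOn (fun t => f x t / t) (Ioi 0))
    (hg_dec : ∀ x ∈ Γ₁, AntitoneOn (fun t => g x t / t) (Ioi 0))
    (C₁ : ℝ) (hC₁ : 0 ≤ C₁)
    (u v : EuclideanSpace ℝ (Fin N) → ℝ)
    (Du Dv : EuclideanSpace ℝ (Fin N) → EuclideanSpace ℝ (Fin N))
    (hu_H1 : IsH1 D u Du) (hv_H1 : IsH1 D v Dv)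
    (hu_cont : ContinuousOn u (closure D)) (hv_cont : ContinuousOn v (closure D))
    (hu_nonneg : ∀ x ∈ closure D, 0 ≤ u x) (hv_nonneg : ∀ x ∈ closure D, 0 ≤ v x)
    (hu_Γ₀ : ∀ x ∈ Γ₀, u x ≤ C₁) (hv_Γ₀ : ∀ x ∈ Γ₀, C₁ ≤ v x)
    (hu_sub : ∀ φ G T, IsH1Zero D Γ₀ φ G T → (∀ᵐ x ∂(volume.restrict D), 0 ≤ φ x) →
      weakForm D Γ₁ f g u Du φ G T ≤ 0)
    (hv_super : ∀ φ G T, IsH1Zero D Γ₀ φ G T → (∀ᵐ x ∂(volume.restrict D), 0 ≤ φ x) →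
      0 ≤ weakForm D Γ₁ f g v Dv φ G T)
    (hv_pos : ∀ x ∈ D, 0 < v x) :
    ∀ x ∈ closure D, u x ≤ v x := by
  have hDm := hD.isOpen.measurableSet
  have hDK : D ⊆ closure D := subset_closure
  have huD := hu_cont.mono hDK
  have hvD := hv_cont.mono hDK
  have hmono : ∀ x ∈ D, v x < u x → 0 < f x (v x) * u x - f x (u x) * v x := by
    intro x hx hlt
    have hvx := hv_pos x hx
    have := hf_dec x hx (mem_Ioi.2 hvx) (mem_Ioi.2 (hvx.trans hlt)) hlt
    exact sub_pos.2 ((div_lt_div_iff₀ (hvx.trans hlt) hvx).1 this)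
  have hfw : ∀ {w : EuclideanSpace ℝ (Fin N) → ℝ}, ContinuousOn w (closure D) →
      (∀ x ∈ closure D, 0 ≤ w x) → ContinuousOn (fun x => f x (w x)) (closure D) :=
    fun hw hw0 => hf.comp (continuousOn_id.prodMk hw) fun x hx => ⟨hx, hw0 x hx⟩
  set J : ℝ → EuclideanSpace ℝ (Fin N) → ℝ := fun k x =>
    (f x (v x) * u x - f x (u x) * v x) * Real.smoothTransition (k * (u x - v x)) with hJ
  have hJint : ∀ k, IntegrableOn (J k) D := fun k => ContinuousOn.integrableOn_of_subset
    (((hfw hv_cont hv_nonneg).mul hu_cont).sub ((hfw hu_cont hu_nonneg).mul hv_cont) |>.mul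
      (Real.smoothTransition.continuous.comp_continuousOn
        (continuousOn_const.mul (hu_cont.sub hv_cont))))
    hD.isBounded.isCompact_closure hDK hDm hD.isBounded.measure_lt_top
  have hJ_zero : ∀ k x, 0 ≤ k → u x ≤ v x → J k x = 0 := fun k x hk h => by
    simp only [hJ]
    rw [Real.smoothTransition.zero_of_nonpos
      (mul_nonpos_of_nonneg_of_nonpos hk (sub_nonpos.2 h)), mul_zero]
  have hJ_nonneg : ∀ x ∈ D, 0 ≤ J 1 x := by
    intro x hx
    rcases le_or_gt (u x) (v x) with h | h
    · rw [hJ_zero 1 x zero_le_one h]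
    · exact mul_nonneg (hmono x hx h).le (Real.smoothTransition.nonneg _)
  -- Where u > v, the cut-off increases with `k` and its coefficient is positive, so `k = 1` bounds
  -- every later `J` from below.
  have hJ_le : ∀ n : ℕ, ∫ x in D, J 1 x ≤ ∫ x in D, J (n + 1) x := by
    intro n
    refine setIntegral_mono_on (hJint _) (hJint _) hDm fun x hx => ?_
    rcases le_or_gt (u x) (v x) with h | h
    · rw [hJ_zero 1 x zero_le_one h, hJ_zero _ x (by positivity) h]
    · refine mul_le_mul_of_nonneg_left (Real.smoothTransition.monotone ?_) (hmono x hx h).le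
      exact mul_le_mul_of_nonneg_right (by simp) (sub_pos.2 h).le
  have hlim := tendsto_integral_mul_deriv_smoothTransition hDm (huD.sub hvD)
    (MemLp.integrable_real_inner hv_H1.memLp_grad (hu_H1.memLp_grad.sub hv_H1.memLp_grad))
  -- The left side no longer depends on `n`, so the limit of the upper bounds applies to it.
  have hJ_nonpos : ∫ x in D, J 1 x ≤ 0 := ge_of_tendsto hlim <| Eventually.of_forall fun n =>
    (hJ_le n).trans (setIntegral_sub_mul_cutoff_le hD hΓ hf hg hg_dec hu_H1 hv_H1 hu_cont hv_cont
      hu_nonneg hv_nonneg (fun x hx => (hu_Γ₀ x hx).trans (hv_Γ₀ x hx)) hu_sub hv_super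
      (by positivity))
  have hae : ∀ᵐ x ∂(volume.restrict D), 0 ≤ J 1 x := by
    filter_upwards [ae_restrict_mem hDm] with x hx using hJ_nonneg x hx
  have hJ_ae : J 1 =ᵐ[volume.restrict D] 0 := (integral_eq_zero_iff_of_nonneg_ae hae (hJint 1)).1
    (le_antisymm hJ_nonpos (integral_nonneg_of_ae hae))
  have hopen : IsOpen (D ∩ {x | 0 < u x - v x}) :=
    (huD.sub hvD).isOpen_inter_preimage hD.isOpen isOpen_Ioi
  have hempty : D ∩ {x | 0 < u x - v x} = ∅ := by
    -- On this set `J 1` is strictly positive, so the set is null, and an open null set is empty.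
    refine hopen.eq_empty_of_measure_zero (μ := volume) ?_
    rw [Filter.EventuallyEq, ae_restrict_iff' hDm] at hJ_ae
    refine measure_mono_null (fun x hx => ?_) hJ_ae
    intro hx'
    refine absurd (hx' hx.1) (mul_pos (hmono x hx.1 (sub_pos.1 hx.2)) ?_).ne'
    exact Real.smoothTransition.pos_of_pos (by simpa using hx.2)
  have hle : ∀ x ∈ D, u x ≤ v x := by
    intro x hx
    by_contra! h
    exact (hempty.le ⟨hx, sub_pos.2 h⟩ : x ∈ (∅ : Set _))
  exact fun x hx => le_on_closure hle hu_cont hv_cont hx
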